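/- Let $V$ be a Euclidean space with inner product $(\cdot,\cdot)$ and let $\Phi\subset V$ be an irreducible (reduced) crystallographic root system with simple system $\Delta$, positive roots $\Phi^+$ and Weyl group $W$. For $\alpha\in\Phi$ and $k\in\mathbb{Z}$ put $\alpha^\vee=\frac{2\alpha}{(\alpha,\alpha)}$, $H_{\alpha,k}=\{y\in V : (y,\alpha^\vee)=k\}$ and $s_{\alpha,k}(y)=y-\big(2\frac{(\alpha,y)}{(\alpha,\alpha)}-k\big)\alpha$, and let $W_a$ be the affine Weyl group, that is, the group of affine transformations of $V$ generated by all $s_{\alpha,k}$. An alcove is a connected component of $V\setminus\bigcup_{\alpha\in\Phi,\,k\in\mathbb{Z}}H_{\alpha,k}$. Let $A_e=\{y : 0<(y,\alpha^\vee)<1 \text{ for all }\alpha\in\Phi^+\}$ and $A_w=w(A_e)$ for $w\in W_a$, and let $P_{\mathcal H}=\{y : 0<(y,\alpha^\vee)<1\text{ for all }\alpha\in\Delta\}$ be the fundamental parallelepiped. A vertex of an alcove is an extreme point of its closure; a wall of an alcove $A$ is a hyperplane $H_{\alpha,k}$ that is the affine span of $H_{\alpha,k}\cap\overline{A}$. Then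 the following hold. 1. The intersection $\bigcap_{\alpha\in\Delta}H_{\alpha,1}$ consists of exactly one point $x$. 2. There is a unique alcove contained in $P_{\mathcal H}$ that has $x$ as a vertex, and it is of the form $A_w$ for exactly one $w\in W_a$. 3. For every $\alpha\in\Delta$ the hyperplane $H_{\alpha,1}$ is a wall of $A_w$. 4. The point $x$ is special, that is, its stabilizer $\mathrm{Stab}_{W_a}(x)$ is isomorphic to $W$. Moreover $\mathrm{Stab}_{W_a}(x)$ is the subgroup generated by the reflections $s_{\alpha,1}$, $\alpha\in\Delta$. -/

import Mathlib

noncomputable section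

namespace AffineWeyl

open scoped RealInnerProductSpace

variable {V : Type*} [NormedAddCommGroup V] [InnerProductSpace ℝ V]

/-- The coroot `α^∨ = 2α / (α, α)` of a vector `α`. -/
def coroot (α : V) : V := (2 / ⟪α, α⟫) • α

/-- The affine reflection `s_{α,k}`: the orthogonal reflection in the hyperplane orthogonal to `α`,
followed by the translation by `k α`. See `affineReflection_apply` for the usual formula. -/
def affineReflection (α : V) (k : ℤ) : V ≃ᵃ[ℝ] V :=
  AffineEquiv.constVAdd ℝ V ((k : ℝ) • α) *
    (ℝ ∙ α)ᗮ.reflection.toLinearEquiv.toAffineEquiv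

theorem affineReflection_apply (α : V) (k : ℤ) (x : V) :
    affineReflection α k x = x - (2 * (⟪α, x⟫ / ⟪α, α⟫) - k) • α := by
  have h : (ℝ ∙ α)ᗮ.reflection x = x - (2 * (⟪α, x⟫ / ⟪α, α⟫)) • α := by
    rw [Submodule.reflection_orthogonal_apply, Submodule.reflection_singleton_apply,
      real_inner_self_eq_norm_sq]
    simp only [RCLike.ofReal_real_eq_id, id_eq]
    module
  change (k : ℝ) • α + (ℝ ∙ α)ᗮ.reflection x = _
  rw [h]
  module

/-- The affine Weyl group `W_a` of a set `Φ` of roots: the group generated by all `s_{α,k}`. -/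
def affineWeylGroup (Φ : Set V) : Subgroup (V ≃ᵃ[ℝ] V) :=
  Subgroup.closure {g | ∃ α ∈ Φ, ∃ k : ℤ, g = affineReflection α k}

/-- The hyperplane `H_{α,k}`. -/
def hyperplane (α : V) (k : ℤ) : Set V := {x | ⟪x, coroot α⟫ = k}

/-- The strip `H_{α,k}^m`. -/
def strip (α : V) (k : ℤ) (m : ℝ) : Set V := {x | (k : ℝ) < ⟪x, coroot α⟫ ∧ ⟪x, coroot α⟫ < k + m}

/-- The collection of all the hyperplanes `H_{α,k}` with `α ∈ Φ` and `k` an integer. -/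
def arrangement (Φ : Set V) : Set (Set V) := {H | ∃ α ∈ Φ, ∃ k : ℤ, H = hyperplane α k}

/-- The intersection of the strips `H_{α,0}^1` for `α ∈ S`. For `S` the set of simple roots this is
the fundamental parallelepiped, for `S` the set of positive roots it is the alcove `A_e`. -/
def stripIntersection (S : Set V) : Set V := ⋂ α ∈ S, strip α 0 1

/-- Alcoves: the connected components of the complement of all the hyperplanes. -/
def IsAlcove (Φ A : Set V) : Prop :=
  ∃ y ∈ (⋃₀ arrangement Φ)ᶜ, A = connectedComponentIn (⋃₀ arrangement Φ)ᶜ y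

/-- A vertex of a convex polytope `A` (possibly without its boundary): an extreme point of its
closure. -/
def IsVertex (A : Set V) (x : V) : Prop := x ∈ (closure A).extremePoints ℝ

/-- A wall of `A`: a hyperplane of the arrangement that is the affine span of its
intersection with the closure of `A`, that is, that supports a facet of `A`. -/
def IsWall (Φ A H : Set V) : Prop :=
  H ∈ arrangement Φ ∧ (affineSpan ℝ (closure A ∩ H) : Set V) = H

/-- The stabilizer of the point `x` in the affine Weyl group. -/
def pointStabilizer (Φ : Set V) (x : V) : Subgroup (V ≃ᵃ[ℝ] V) where
  carrier := {g | g ∈ affineWeylGroup Φ ∧ g x = x}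
  mul_mem' := fun {a b} ha hb => ⟨mul_mem ha.1 hb.1, by
    change a (b x) = x
    rw [hb.2, ha.2]⟩
  one_mem' := ⟨one_mem _, rfl⟩
  inv_mem' := fun {a} ha => ⟨inv_mem ha.1, by
    change a.symm x = x
    rw [AffineEquiv.symm_apply_eq, ha.2]⟩

section RootSystem

variable {ι N : Type*} [AddCommGroup N] [Module ℝ N]

/-- A root system is Euclidean if its reflections are the orthogonal reflections for the inner
product of `V`. Then the linear form given by the coroot of `α` is `x ↦ (x, α^∨)`. -/
def IsEuclidean (P : RootPairing ι ℝ V N) : Prop :=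
  ∀ i x, P.reflection i x = x - (2 * (⟪P.root i, x⟫ / ⟪P.root i, P.root i⟫)) • P.root i

/-- The set `Φ` of all roots. -/
def roots (P : RootPairing ι ℝ V N) : Set V := Set.range P.root

/-- The simple system `Δ`. -/
def simpleRoots {P : RootPairing ι ℝ V N} (b : P.Base) : Set V := P.root '' b.support

/-- The set `Φ⁺` of the positive roots: those that are sums of simple roots. -/
def positiveRoots {P : RootPairing ι ℝ V N} (b : P.Base) : Set V :=
  {α | α ∈ Set.range P.root ∧ α ∈ AddSubmonoid.closure (P.root '' b.support)}

/-- The fundamental parallelepiped. -/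
def parallelepiped {P : RootPairing ι ℝ V N} (b : P.Base) : Set V :=
  stripIntersection (simpleRoots b)

/-- The set `A_w = w A_e`, where `A_e` is the intersection of the strips `H_{α,0}^1` over the
positive roots. -/
def alcove {P : RootPairing ι ℝ V N} (b : P.Base) (w : V ≃ᵃ[ℝ] V) : Set V :=
  w '' stripIntersection (positiveRoots b)

/-- A point is special if its stabilizer in `W_a` is isomorphic to the Weyl group `W`. -/
def IsSpecial (P : RootPairing ι ℝ V N) (x : V) : Prop :=
  Nonempty (pointStabilizer (roots P) x ≃* P.weylGroup)

end RootSystem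

end AffineWeyl

end

/-!
Everything is expressed through the linear forms `P.coroot' i`, which for a Euclidean root system
are `z ↦ (z, α^∨)`. The simple coroots form a basis of the dual space, so there is exactly one
point `x` at which all of them take the value `1`. As every positive coroot is a sum of simple
coroots (`IsEuclidean.exists_coroot'_eq_sum_of_isPos`), all `(x, α^∨)` are integers. Hence the point
reflection `z ↦ x - z` permutes the hyperplanes `H_{α,k}`, and the alcove in question is
`x - A_e` (`oppositeAlcove`).

* Alcoves are the sets of points with prescribed integral parts of all `(z, α^∨)`
  (`connectedComponentIn_regularPoints`). Near `x`, an alcove in the fundamental parallelepiped can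
  only lie just below each hyperplane `H_{α,(x,α^∨)}` with `α` positive, so it is `x - A_e`.
* `W_a` is transitive on alcoves: in the orbit of a regular point, the point closest to a given
  point of `A_e` lies in `A_e`, because the reflection in a separating hyperplane would bring it
  closer (`IsEuclidean.exists_apply_mem_stripIntersection`).
* `W_a` is free on alcoves (`IsEuclidean.eq_one_of_image_stripIntersection`). If `g` preserves
  `A_e`, then `g 0` is a vector of the root lattice in the closure of `A_e`, where all `(z, α^∨)`
  are at most `1`. But a vector `l ≠ 0` of the root lattice, written as a sum of as few roots as
  possible, involves no two roots at an obtuse angle, so `(l, α^∨) ≥ 2` for each of these roots `α`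
  (`RootPairing.exists_two_le_coroot'_sum`). Hence `g 0 = 0`, so `g` is an element of
  the Weyl group that preserves the positive roots, and it is the identity by the exchange condition
  (`RootPairing.Base.exists_shorter_list_of_not_isPos`).
* The closure of `x - A_e` contains `x - v` for all small dominant `v`. Those `v` that are
  orthogonal to a simple root `α` span the hyperplane orthogonal to `α`, so `H_{α,1}` is a wall.
* The linear part is injective on the stabilizer of `x`, and conjugating the Weyl group by the
  translation by `x` carries the simple reflection `s_α` to `s_{α,1}`. The stabilizer is therefore
  this conjugate, and it is generated by the `s_{α,1}` because the Weyl group is generated by the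
  simple reflections.
-/

noncomputable section

/-! ### The Weyl group and its simple reflections -/

namespace RootPairing

variable {ι R M N : Type*} [CommRing R] [AddCommGroup M] [Module R M] [AddCommGroup N] [Module R N]
  {P : RootPairing ι R M N}

lemma Equiv.aut_smul_root (u : P.Aut) (i : ι) : u • P.root i = P.root (u • i) :=
  (Equiv.root_indexEquiv_eq_smul P i u).symm

lemma coroot'_aut_smul (u : P.Aut) (i : ι) (z : M) :
    P.coroot' (u • i) (u • z) = P.coroot' i z := by
  have h1 := LinearMap.congr_fun
    (Hom.weight_coweight_transpose_apply P P (P.coroot (u • i)) u.toHom) z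
  have h2 : u.coweightMap (P.coroot (u • i)) = P.coroot i := by
    refine (Hom.coroot_coweightMap_apply P P (u • i) u.toHom).trans (congrArg P.coroot ?_)
    exact u.indexEquiv.symm_apply_apply i
  rw [h2] at h1
  exact h1

lemma aut_smul_reflectionPerm_self (u : P.Aut) (i : ι) :
    u • P.reflectionPerm i i = P.reflectionPerm (u • i) (u • i) := by
  apply P.root.injective
  rw [← Equiv.aut_smul_root, root_reflectionPerm, root_reflectionPerm, reflection_apply_self,
    reflection_apply_self, smul_neg, Equiv.aut_smul_root]

lemma Equiv.reflection_aut_smul (u : P.Aut) (i : ι) :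
    Equiv.reflection P (u • i) = u * Equiv.reflection P i * u⁻¹ := by
  rw [eq_mul_inv_iff_mul_eq]
  apply Equiv.weightHom_injective P
  ext z
  change Equiv.reflection P (u • i) • (u • z) = u • (Equiv.reflection P i • z)
  simp only [Equiv.reflection_smul, P.reflection_apply]
  rw [coroot'_aut_smul, smul_sub, smul_comm u (P.coroot' i z) (P.root i), Equiv.aut_smul_root]

namespace Base

variable [CharZero R] [IsDomain R] [Finite ι] [P.IsCrystallographic] [P.IsReduced]

/-- The Weyl group is generated by the simple reflections, since every root is obtained from a
simple one by simple reflections, and these conjugate reflections to reflections. -/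
lemma weylGroup_eq_closure_simple (b : P.Base) :
    P.weylGroup = Subgroup.closure (Equiv.reflection P '' b.support) := by
  refine le_antisymm ((Subgroup.closure_le _).2 ?_)
    (Subgroup.closure_mono (Set.image_subset_range _ _))
  rintro _ ⟨i, rfl⟩
  have conj (i j : ι)
      (hi : Equiv.reflection P i ∈ Subgroup.closure (Equiv.reflection P '' b.support))
      (hj : Equiv.reflection P j ∈ Subgroup.closure (Equiv.reflection P '' b.support)) :
      Equiv.reflection P (P.reflectionPerm j i) ∈
        Subgroup.closure (Equiv.reflection P '' b.support) := by
    have := Equiv.reflection_aut_smul (Equiv.reflection P j) i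
    change Equiv.reflection P (P.reflectionPerm j i) = _ at this
    rw [this]
    exact mul_mem (mul_mem hj hi) (inv_mem hj)
  exact b.induction_reflect i
    (p := fun i ↦ Equiv.reflection P i ∈ Subgroup.closure (Equiv.reflection P '' b.support))
    (fun i hi ↦ conj i i hi hi) (fun i hi ↦ Subgroup.subset_closure ⟨i, hi, rfl⟩)
    (fun i j hi hj ↦ conj i j hi (Subgroup.subset_closure ⟨j, hj, rfl⟩))

/-- The exchange condition: if a product `w` of simple reflections makes the simple root `i`
negative, then `w * s i` is a product of fewer simple reflections. The factor that is dropped is the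
one that turns the image of `i` from positive to negative. -/
lemma exists_shorter_list_of_not_isPos (b : P.Base) {i : ι} (hi : i ∈ b.support) (L : List ι)
    (hL : ∀ j ∈ L, j ∈ b.support)
    (h : ¬ b.IsPos ((L.map (Equiv.reflection P)).prod • i)) :
    ∃ L' : List ι, (∀ j ∈ L', j ∈ b.support) ∧ L'.length < L.length ∧
      (L'.map (Equiv.reflection P)).prod =
        (L.map (Equiv.reflection P)).prod * Equiv.reflection P i := by
  induction L with
  | nil => exact absurd (b.isPos_of_mem_support hi) (by simpa using h)
  | cons j L ih =>
    rw [List.forall_mem_cons] at hL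
    by_cases h' : b.IsPos ((L.map (Equiv.reflection P)).prod • i)
    · refine ⟨L, hL.2, by simp, ?_⟩
      have hj : (L.map (Equiv.reflection P)).prod • i = j := by
        by_contra hne
        refine h ?_
        rw [List.map_cons, List.prod_cons, mul_smul]
        exact h'.reflectionPerm hL.1 hne
      rw [List.map_cons, List.prod_cons, ← hj, Equiv.reflection_aut_smul]
      have hii : Equiv.reflection P i * Equiv.reflection P i = 1 := by
        rw [mul_eq_one_iff_inv_eq, Equiv.reflection_inv]
      rw [inv_mul_cancel_right, mul_assoc, hii, mul_one]
    · obtain ⟨L', h1, h2, h3⟩ := ih hL.2 h'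
      refine ⟨j :: L', by simpa using ⟨hL.1, h1⟩, by simpa using h2, ?_⟩
      rw [List.map_cons, List.prod_cons, h3, List.map_cons, List.prod_cons, mul_assoc]

lemma exists_list_of_mem_weylGroup (b : P.Base) {u : P.Aut} (hu : u ∈ P.weylGroup) :
    ∃ L : List ι, (∀ j ∈ L, j ∈ b.support) ∧ (L.map (Equiv.reflection P)).prod = u := by
  rw [b.weylGroup_eq_closure_simple] at hu
  induction hu using Subgroup.closure_induction'' with
  | one => exact ⟨[], by simp, by simp⟩
  | mem _ h =>
    obtain ⟨i, hi, rfl⟩ := h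
    exact ⟨[i], by simpa using hi, by simp⟩
  | inv_mem _ h =>
    obtain ⟨i, hi, rfl⟩ := h
    exact ⟨[i], by simpa using hi, by simp⟩
  | mul _ _ _ _ h1 h2 =>
    obtain ⟨L1, h1, rfl⟩ := h1
    obtain ⟨L2, h2, rfl⟩ := h2
    refine ⟨L1 ++ L2, ?_, by simp⟩
    simp only [List.mem_append]
    rintro j (hj | hj)
    exacts [h1 j hj, h2 j hj]

/-- This is the freeness of the action of the Weyl group on the chambers: an element that maps the
simple roots to positive roots fixes the chamber of the base. -/
lemma eq_one_of_forall_isPos_smul (b : P.Base) {u : P.Aut} (hu : u ∈ P.weylGroup)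
    (h : ∀ i ∈ b.support, b.IsPos (u • i)) : u = 1 := by
  obtain ⟨L, hL, rfl⟩ := b.exists_list_of_mem_weylGroup hu
  clear hu
  induction hn : L.length using Nat.strong_induction_on generalizing L with
  | _ n ih =>
    rcases L.eq_nil_or_concat' with rfl | ⟨L, i, rfl⟩
    · simp
    simp only [List.mem_append, List.mem_singleton] at hL
    have hi : i ∈ b.support := hL i (Or.inr rfl)
    have hneg : ¬ b.IsPos ((L.map (Equiv.reflection P)).prod • i) := by
      have := h i hi
      rw [List.map_append, List.prod_append, mul_smul, List.map_singleton, List.prod_singleton]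
        at this
      change b.IsPos (_ • P.reflectionPerm i i) at this
      rw [aut_smul_reflectionPerm_self] at this
      exact (IsPos.neg_iff_not b _).1 this
    obtain ⟨L', h1, h2, h3⟩ :=
      b.exists_shorter_list_of_not_isPos hi L (fun j hj ↦ hL j (Or.inl hj)) hneg
    have h4 : (L'.map (Equiv.reflection P)).prod =
        ((L ++ [i]).map (Equiv.reflection P)).prod := by simp [h3]
    rw [← h4] at h ⊢
    simp only [List.length_append, List.length_singleton] at hn
    exact ih _ (by omega) L' h1 h rfl

end Base

end RootPairing

/-! ### The root lattice and positive roots -/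

namespace RootPairing

variable {ι M N : Type*} [Finite ι] [AddCommGroup M] [Module ℝ M] [AddCommGroup N] [Module ℝ N]
  {P : RootPairing ι ℝ M N} [P.IsCrystallographic]

/-- A nonzero sum `l` of roots satisfies `(l, α^∨) ≥ 2` for some root `α`. Two summands at an obtuse
angle can be replaced by their sum, which is a root or zero; if there are none, then any of the
summands serves as `α`. -/
lemma exists_two_le_coroot'_sum (s : Multiset ι) (hs : (s.map P.root).sum ≠ 0) :
    ∃ i, 2 ≤ P.coroot' i (s.map P.root).sum := by
  induction hn : s.card using Nat.strong_induction_on generalizing s with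
  | _ n ih =>
  induction s using Multiset.induction_on with
  | empty => simp at hs
  | cons i t _ =>
    rw [Multiset.card_cons] at hn
    by_cases h : ∃ j ∈ t, P.pairingIn ℤ j i < 0
    · obtain ⟨j, hj, hji⟩ := h
      obtain ⟨t, rfl⟩ := Multiset.exists_cons_of_mem hj
      rw [Multiset.card_cons] at hn
      rw [Multiset.map_cons, Multiset.map_cons, Multiset.sum_cons, Multiset.sum_cons,
        ← add_assoc, add_comm (P.root i)] at hs ⊢
      by_cases hij : P.root j = - P.root i
      · rw [hij, neg_add_cancel, zero_add] at hs ⊢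
        exact ih _ (by omega) t hs rfl
      · obtain ⟨k, hk⟩ := P.root_add_root_mem_of_pairingIn_neg hji hij
        rw [← hk, ← Multiset.sum_cons, ← Multiset.map_cons] at hs ⊢
        exact ih (t.card + 1) (by omega) (k ::ₘ t) hs (by simp)
    · push Not at h
      refine ⟨i, ?_⟩
      rw [Multiset.map_cons, Multiset.sum_cons, map_add, map_multiset_sum, Multiset.map_map]
      have h2 : P.coroot' i (P.root i) = 2 := by simp
      have h0 : 0 ≤ (t.map (P.coroot' i ∘ P.root)).sum := by
        refine Multiset.sum_nonneg fun y hy ↦ ?_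
        obtain ⟨j, hj, rfl⟩ := Multiset.mem_map.1 hy
        have := h j hj
        simp only [Function.comp_apply, root_coroot'_eq_pairing]
        rw [← P.algebraMap_pairingIn ℤ]
        simpa using this
      linarith

lemma eq_zero_of_mem_closure_root_of_coroot'_le_one {l : M}
    (hl : l ∈ AddSubgroup.closure (Set.range P.root))
    (h : ∀ i, P.coroot' i l ≤ 1) : l = 0 := by
  obtain ⟨s, rfl⟩ : ∃ s : Multiset ι, (s.map P.root).sum = l := by
    clear h
    induction hl using AddSubgroup.closure_induction with
    | zero => exact ⟨0, by simp⟩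
    | mem _ h =>
      obtain ⟨i, rfl⟩ := h
      exact ⟨{i}, by simp⟩
    | add _ _ _ _ h1 h2 =>
      obtain ⟨s, rfl⟩ := h1
      obtain ⟨t, rfl⟩ := h2
      exact ⟨s + t, by simp⟩
    | neg _ _ h1 =>
      obtain ⟨s, rfl⟩ := h1
      refine ⟨s.map fun i ↦ P.reflectionPerm i i, ?_⟩
      simp [Multiset.map_map, root_reflectionPerm]
  by_contra h0
  obtain ⟨i, hi⟩ := exists_two_le_coroot'_sum s h0
  linarith [h i]

namespace Base

variable [P.IsRootSystem]

omit [Finite ι] [P.IsCrystallographic] in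
lemma exists_coroot'_eq (b : P.Base) (c : ι → ℝ) : ∃ z, ∀ j ∈ b.support, P.coroot' j z = c j := by
  let f := b.toCoweightBasis.constr ℝ fun j ↦ c j
  refine ⟨P.toLinearMap.toPerfPair.symm f, fun j hj ↦ ?_⟩
  have h1 : P.toLinearMap (P.toLinearMap.toPerfPair.symm f) = f :=
    P.toLinearMap.toPerfPair.apply_symm_apply f
  have h2 : f (P.coroot j) = c j := by
    have := b.toCoweightBasis.constr_basis ℝ (fun j ↦ c j) ⟨j, hj⟩
    rwa [b.toCoweightBasis_apply] at this
  rw [← h2, ← h1]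
  simp [coroot']

omit [Finite ι] [P.IsCrystallographic] in
lemma eq_of_forall_coroot'_eq (b : P.Base) {y z : M}
    (h : ∀ j ∈ b.support, P.coroot' j y = P.coroot' j z) : y = z := by
  apply P.toLinearMap.toPerfPair.injective
  refine b.toCoweightBasis.ext fun j ↦ ?_
  rw [b.toCoweightBasis_apply]
  exact h j j.2

omit [Finite ι] [P.IsCrystallographic] [P.IsRootSystem] in
lemma isPos_iff_root_mem_closure (b : P.Base) (i : ι) :
    b.IsPos i ↔ P.root i ∈ AddSubmonoid.closure (P.root '' b.support) := by
  classical
  have key (i : ι) (hi : P.root i ∈ AddSubmonoid.closure (P.root '' b.support)) : b.IsPos i := by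
    rw [← Submodule.span_nat_eq_addSubmonoidClosure, Submodule.mem_toAddSubmonoid,
      Submodule.mem_span_image_finset_iff_exists_fun] at hi
    obtain ⟨f, hf⟩ := hi
    have hf' : P.root i = ∑ j ∈ b.support,
        (if hj : j ∈ b.support then (f ⟨j, hj⟩ : ℤ) else 0) • P.root j := by
      rw [← hf, ← Finset.sum_coe_sort b.support]
      exact Finset.sum_congr rfl fun j _ ↦ by simp
    rw [b.isPos_iff', height_eq_sum hf']
    exact Finset.sum_nonneg fun j _ ↦ by split_ifs; positivity
  refine ⟨fun hi ↦ (b.root_mem_or_neg_mem i).resolve_right fun h ↦ ?_, key i⟩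
  refine (IsPos.neg_iff_not b i).1 (key _ ?_) hi
  simpa [root_reflectionPerm] using h

end Base

end RootPairing

namespace AffineWeyl

open RootPairing Set Topology
open scoped RealInnerProductSpace

/-! ### Euclidean root systems and the affine Weyl group -/

section Euclidean

variable {ι V N : Type*} [NormedAddCommGroup V] [InnerProductSpace ℝ V]
    [AddCommGroup N] [Module ℝ N] {P : RootPairing ι ℝ V N}

lemma IsEuclidean.coroot'_eq (hP : IsEuclidean P) (i : ι) (z : V) :
    P.coroot' i z = 2 * (⟪P.root i, z⟫ / ⟪P.root i, P.root i⟫) := by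
  have h := hP i z
  rw [P.reflection_apply] at h
  exact smul_left_injective ℝ (P.ne_zero i) (sub_right_injective h)

lemma IsEuclidean.inner_coroot (hP : IsEuclidean P) (i : ι) (z : V) :
    ⟪z, coroot (P.root i)⟫ = P.coroot' i z := by
  rw [hP.coroot'_eq, coroot, inner_smul_right, real_inner_comm z]
  ring

lemma inner_root_self_pos (P : RootPairing ι ℝ V N) (i : ι) : 0 < ⟪P.root i, P.root i⟫ :=
  real_inner_self_pos.2 (P.ne_zero i)

lemma IsEuclidean.inner_root (hP : IsEuclidean P) (i : ι) (z : V) :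
    ⟪P.root i, z⟫ = P.coroot' i z * ⟪P.root i, P.root i⟫ / 2 := by
  have := (inner_root_self_pos P i).ne'
  rw [hP.coroot'_eq]
  field_simp

lemma IsEuclidean.affineReflection_eq (hP : IsEuclidean P) (i : ι) (k : ℤ) (z : V) :
    affineReflection (P.root i) k z = z - (P.coroot' i z - k) • P.root i := by
  rw [affineReflection_apply, hP.coroot'_eq]

lemma IsEuclidean.hyperplane_eq (hP : IsEuclidean P) (i : ι) (k : ℤ) :
    hyperplane (P.root i) k = {z | P.coroot' i z = k} := by
  simp only [hyperplane, hP.inner_coroot]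

/-- Positive coroots are sums of simple coroots. A base asserts this only up to sign; the sign is
that of the values at the point where all simple coroots equal `1`. -/
lemma IsEuclidean.exists_coroot'_eq_sum_of_isPos [P.IsRootSystem]
    (hP : IsEuclidean P) (b : P.Base) {i : ι} (hi : b.IsPos i) :
    ∃ f : ι → ℕ, 1 ≤ ∑ j ∈ b.support, f j ∧
      ∀ z, P.coroot' i z = ∑ j ∈ b.support, (f j : ℝ) * P.coroot' j z := by
  obtain ⟨y, hy⟩ := b.exists_coroot'_eq fun _ ↦ 1
  have hyi : 0 ≤ P.coroot' i y := by
    have h : 0 ≤ ⟪P.root i, y⟫ := by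
      have hcl := (b.isPos_iff_root_mem_closure i).1 hi
      generalize P.root i = v at hcl
      induction hcl using AddSubmonoid.closure_induction with
      | mem _ h =>
        obtain ⟨j, hj, rfl⟩ := h
        rw [hP.inner_root, hy j hj]
        have := inner_root_self_pos P j
        positivity
      | zero => simp
      | add v w _ _ hv hw => rw [inner_add_left]; positivity
    rw [hP.coroot'_eq]
    have := inner_root_self_pos P i
    positivity
  obtain ⟨f, -, hf⟩ := b.flip.exists_root_eq_sum_nat_or_neg i
  change P.coroot i = ∑ j ∈ b.support, f j • P.coroot j ∨
    P.coroot i = -∑ j ∈ b.support, f j • P.coroot j at hf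
  have hsum : 1 ≤ ∑ j ∈ b.support, f j := by
    rw [Nat.one_le_iff_ne_zero]
    intro h0
    rw [Finset.sum_eq_zero_iff] at h0
    have h1 : ∑ j ∈ b.support, f j • P.coroot j = 0 :=
      Finset.sum_eq_zero fun j hj ↦ by rw [h0 j hj, zero_smul]
    rw [h1, neg_zero, or_self] at hf
    exact P.flip.ne_zero i hf
  have key (z : V) : P.toLinearMap z (∑ j ∈ b.support, f j • P.coroot j) =
      ∑ j ∈ b.support, (f j : ℝ) * P.coroot' j z := by
    simp [coroot']
  refine ⟨f, hsum, fun z ↦ ?_⟩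
  rcases hf with hf | hf
  · rw [← key, ← hf]
    rfl
  · -- The second alternative would make the coroot negative on the dominant point `y`.
    exfalso
    have h1 : P.coroot' i y = - ∑ j ∈ b.support, (f j : ℝ) * P.coroot' j y := by
      rw [← key, ← map_neg, ← hf]
      rfl
    rw [Finset.sum_congr rfl fun j hj ↦ by rw [hy j hj, mul_one], ← Nat.cast_sum] at h1
    have h2 : (1 : ℝ) ≤ (∑ j ∈ b.support, f j : ℕ) := by exact_mod_cast hsum
    linarith

lemma coroot'_reflectionPerm_self (P : RootPairing ι ℝ V N) (i : ι) (z : V) :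
    P.coroot' (P.reflectionPerm i i) z = -P.coroot' i z := by
  simp [coroot', coroot_reflectionPerm]

/-- The elements of the affine Weyl group are the compositions of an element of the Weyl group
with a translation by an element of the root lattice. -/
lemma IsEuclidean.exists_eq_smul_add (hP : IsEuclidean P) {g : V ≃ᵃ[ℝ] V}
    (hg : g ∈ affineWeylGroup (roots P)) :
    ∃ u ∈ P.weylGroup, ∃ l ∈ AddSubgroup.closure (range P.root), ∀ z, g z = u • z + l := by
  have smul_mem (u : P.Aut) (l : V) (hl : l ∈ AddSubgroup.closure (range P.root)) :
      u • l ∈ AddSubgroup.closure (range P.root) := by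
    induction hl using AddSubgroup.closure_induction with
    | zero => simp
    | mem _ h =>
      obtain ⟨i, rfl⟩ := h
      rw [Equiv.aut_smul_root]
      exact AddSubgroup.subset_closure (mem_range_self _)
    | add _ _ _ _ h1 h2 => rw [smul_add]; exact add_mem h1 h2
    | neg _ _ h => rw [smul_neg]; exact neg_mem h
  induction hg using Subgroup.closure_induction with
  | one => exact ⟨1, one_mem _, 0, zero_mem _, fun z ↦ by simp⟩
  | mem _ h =>
    obtain ⟨_, ⟨i, rfl⟩, k, rfl⟩ := h
    refine ⟨_, P.reflection_mem_weylGroup i, k • P.root i,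
      zsmul_mem (AddSubgroup.subset_closure (mem_range_self i)) k, fun z ↦ ?_⟩
    rw [hP.affineReflection_eq, Equiv.reflection_smul, reflection_apply, sub_smul,
      Int.cast_smul_eq_zsmul]
    abel
  | mul g h _ _ h1 h2 =>
    obtain ⟨u, hu, l, hl, h1⟩ := h1
    obtain ⟨v, hv, m, hm, h2⟩ := h2
    refine ⟨u * v, mul_mem hu hv, u • m + l, add_mem (smul_mem u m hm) hl, fun z ↦ ?_⟩
    rw [AffineEquiv.coe_mul, Function.comp_apply, h1, h2, smul_add, mul_smul, add_assoc]
  | inv g _ h1 =>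
    obtain ⟨u, hu, l, hl, h1⟩ := h1
    refine ⟨u⁻¹, inv_mem hu, -(u⁻¹ • l), neg_mem (smul_mem _ l hl), fun z ↦ ?_⟩
    apply g.injective
    have : g (g⁻¹ z) = z := g.apply_symm_apply z
    rw [this, h1, smul_add, smul_neg, smul_inv_smul, smul_inv_smul, neg_add_cancel_right]

lemma exists_coroot'_eq_intCast [P.IsCrystallographic] {l : V}
    (hl : l ∈ AddSubgroup.closure (range P.root)) (i : ι) : ∃ n : ℤ, P.coroot' i l = n := by
  induction hl using AddSubgroup.closure_induction with
  | zero => exact ⟨0, by simp⟩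
  | mem _ h =>
    obtain ⟨j, rfl⟩ := h
    refine ⟨P.pairingIn ℤ j i, ?_⟩
    rw [root_coroot'_eq_pairing, ← P.algebraMap_pairingIn ℤ]
    rfl
  | add _ _ _ _ h1 h2 =>
    obtain ⟨m, h1⟩ := h1
    obtain ⟨n, h2⟩ := h2
    exact ⟨m + n, by rw [map_add, h1, h2, Int.cast_add]⟩
  | neg _ _ h =>
    obtain ⟨m, h⟩ := h
    exact ⟨-m, by rw [map_neg, h, Int.cast_neg]⟩

lemma IsEuclidean.exists_coroot'_apply_eq [P.IsCrystallographic] (hP : IsEuclidean P)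
    {g : V ≃ᵃ[ℝ] V} (hg : g ∈ affineWeylGroup (roots P)) (i : ι) :
    ∃ (j : ι) (n : ℤ), ∀ z, P.coroot' i (g z) = P.coroot' j z + n := by
  obtain ⟨u, -, l, hl, h⟩ := hP.exists_eq_smul_add hg
  obtain ⟨n, hn⟩ := exists_coroot'_eq_intCast hl i
  refine ⟨u⁻¹ • i, n, fun z ↦ ?_⟩
  have := coroot'_aut_smul u (u⁻¹ • i) z
  rw [smul_inv_smul] at this
  rw [h, map_add, hn, this]

/-! ### Alcoves as cells of the arrangement -/

/-- The points lying on none of the hyperplanes `H_{α,k}`. -/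
def regularPoints (P : RootPairing ι ℝ V N) : Set V := {z | ∀ i, ∀ k : ℤ, P.coroot' i z ≠ k}

/-- The set of the points lying strictly between the same consecutive hyperplanes as `y`, for each
root. For regular `y` this is the alcove of `y`; for other `y` it does not contain `y`. -/
def cell (P : RootPairing ι ℝ V N) (y : V) : Set V :=
  {z | ∀ i, (⌊P.coroot' i y⌋ : ℝ) < P.coroot' i z ∧ P.coroot' i z < ⌊P.coroot' i y⌋ + 1}

lemma IsEuclidean.compl_sUnion_arrangement (hP : IsEuclidean P) :
    (⋃₀ arrangement (roots P))ᶜ = regularPoints P := by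
  ext z
  simp only [mem_compl_iff, mem_sUnion, arrangement, mem_ofPred_eq, regularPoints, not_exists]
  constructor
  · intro h i k hz
    exact h _ ⟨⟨P.root i, ⟨i, rfl⟩, k, rfl⟩, by rwa [hP.hyperplane_eq]⟩
  · rintro h _ ⟨⟨_, ⟨i, rfl⟩, k, rfl⟩, hz⟩
    rw [hP.hyperplane_eq] at hz
    exact h i k hz

lemma mem_cell_self {y : V} (hy : y ∈ regularPoints P) : y ∈ cell P y := fun i ↦
  ⟨lt_of_le_of_ne (Int.floor_le _) (hy i _).symm, Int.lt_floor_add_one _⟩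

lemma floor_eq_of_mem_cell {y z : V} (h : z ∈ cell P y) (i : ι) :
    ⌊P.coroot' i z⌋ = ⌊P.coroot' i y⌋ :=
  Int.floor_eq_iff.2 ⟨(h i).1.le, (h i).2⟩

lemma cell_eq_of_mem {y z : V} (h : z ∈ cell P y) : cell P z = cell P y := by
  simp only [cell, floor_eq_of_mem_cell h]

lemma cell_subset_regularPoints (y : V) : cell P y ⊆ regularPoints P := by
  intro z hz i k hk
  have h1 := floor_eq_of_mem_cell hz i
  rw [hk, Int.floor_intCast] at h1
  have h2 := (hz i).1
  rw [← h1, hk] at h2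
  exact lt_irrefl _ h2

lemma convex_cell (y : V) : Convex ℝ (cell P y) := by
  have : cell P y = ⋂ i, P.coroot' i ⁻¹' Ioo (⌊P.coroot' i y⌋ : ℝ) (⌊P.coroot' i y⌋ + 1) := by
    ext z
    simp [cell]
  rw [this]
  exact convex_iInter fun i ↦ (convex_Ioo _ _).linear_preimage _

lemma connectedComponentIn_regularPoints [FiniteDimensional ℝ V] {y : V}
    (hy : y ∈ regularPoints P) : connectedComponentIn (regularPoints P) y = cell P y := by
  refine subset_antisymm (fun z hz i ↦ ?_)
    ((convex_cell y).isPreconnected.subset_connectedComponentIn (mem_cell_self hy)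
      (cell_subset_regularPoints y))
  have hcont : Continuous (P.coroot' i) := LinearMap.continuous_of_finiteDimensional _
  have hconn := (isPreconnected_connectedComponentIn (x := y) (F := regularPoints P)).image
    _ hcont.continuousOn
  have hoc := hconn.ordConnected
  have hy' := mem_image_of_mem (P.coroot' i) (mem_connectedComponentIn hy)
  have hz' := mem_image_of_mem (P.coroot' i) hz
  have hint (k : ℤ) : (k : ℝ) ∉ P.coroot' i '' connectedComponentIn (regularPoints P) y := by
    rintro ⟨v, hv, hvk⟩
    exact connectedComponentIn_subset _ _ hv i k hvk
  constructor
  · by_contra! h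
    exact hint _ (hoc.out hz' hy' ⟨h, Int.floor_le _⟩)
  · by_contra! h
    refine hint (⌊P.coroot' i y⌋ + 1) (hoc.out hy' hz' ⟨?_, ?_⟩)
    · push_cast
      exact (Int.lt_floor_add_one _).le
    · push_cast
      exact h

lemma IsEuclidean.isAlcove_iff [FiniteDimensional ℝ V] (hP : IsEuclidean P) (A : Set V) :
    IsAlcove (roots P) A ↔ ∃ y ∈ regularPoints P, A = cell P y := by
  rw [IsAlcove, hP.compl_sUnion_arrangement]
  refine exists_congr fun y ↦ and_congr_right fun hy ↦ ?_
  rw [connectedComponentIn_regularPoints hy]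

section Crystallographic

variable [P.IsCrystallographic]

lemma IsEuclidean.image_cell (hP : IsEuclidean P) {g : V ≃ᵃ[ℝ] V}
    (hg : g ∈ affineWeylGroup (roots P)) (y : V) : g '' cell P y = cell P (g y) := by
  have key (g : V ≃ᵃ[ℝ] V) (hg : g ∈ affineWeylGroup (roots P)) (y z : V) (hz : z ∈ cell P y) :
      g z ∈ cell P (g y) := by
    intro i
    obtain ⟨j, n, h⟩ := hP.exists_coroot'_apply_eq hg i
    rw [h, h, Int.floor_add_intCast]
    push_cast
    constructor <;> linarith [hz j]
  refine subset_antisymm (image_subset_iff.2 (key g hg y)) fun z hz ↦ ⟨g⁻¹ z, ?_, ?_⟩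
  · have := key g⁻¹ (inv_mem hg) _ _ hz
    rwa [show g⁻¹ (g y) = y from g.symm_apply_apply y] at this
  · exact g.apply_symm_apply z

lemma IsEuclidean.apply_mem_regularPoints (hP : IsEuclidean P) {g : V ≃ᵃ[ℝ] V}
    (hg : g ∈ affineWeylGroup (roots P)) {y : V} (hy : y ∈ regularPoints P) :
    g y ∈ regularPoints P := by
  intro i k hk
  obtain ⟨j, n, h⟩ := hP.exists_coroot'_apply_eq hg i
  refine hy j (k - n) ?_
  rw [h] at hk
  push_cast
  linarith

end Crystallographic

end Euclidean

/-! ### Simple transitivity on alcoves -/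

section Transitivity

variable {ι V N : Type*} [NormedAddCommGroup V] [InnerProductSpace ℝ V]
    [AddCommGroup N] [Module ℝ N] {P : RootPairing ι ℝ V N}

lemma IsEuclidean.mem_stripIntersection_positiveRoots (hP : IsEuclidean P) (b : P.Base) {z : V} :
    z ∈ stripIntersection (positiveRoots b) ↔
      ∀ i, b.IsPos i → 0 < P.coroot' i z ∧ P.coroot' i z < 1 := by
  simp only [stripIntersection, mem_iInter, strip, mem_ofPred_eq, Int.cast_zero, zero_add]
  constructor
  · intro h i hi
    rw [← hP.inner_coroot]
    exact h _ ⟨⟨i, rfl⟩, (b.isPos_iff_root_mem_closure i).1 hi⟩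
  · rintro h _ ⟨⟨i, rfl⟩, hi⟩
    rw [hP.inner_coroot]
    exact h i ((b.isPos_iff_root_mem_closure i).2 hi)

lemma IsEuclidean.mem_parallelepiped (hP : IsEuclidean P) (b : P.Base) {z : V} :
    z ∈ parallelepiped b ↔ ∀ i ∈ b.support, 0 < P.coroot' i z ∧ P.coroot' i z < 1 := by
  simp only [parallelepiped, stripIntersection, simpleRoots, biInter_image, mem_iInter, strip,
    mem_ofPred_eq, Int.cast_zero, zero_add, hP.inner_coroot, Finset.mem_coe]

lemma isPos_or_exists_coroot'_eq_neg (b : P.Base) (i : ι) :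
    b.IsPos i ∨ ∃ j, b.IsPos j ∧ ∀ z, P.coroot' i z = -P.coroot' j z := by
  refine (Base.IsPos.or_neg b i).imp_right fun h ↦ ⟨_, h, fun z ↦ ?_⟩
  exact (neg_eq_iff_eq_neg.2 (coroot'_reflectionPerm_self P i z)).symm

/-- A cell is determined by the strips of the positive roots alone. -/
lemma mem_regularPoints_and_cell_eq (b : P.Base) {y : V} (n : ι → ℤ)
    (h : ∀ i, b.IsPos i → n i < P.coroot' i y ∧ P.coroot' i y < n i + 1) :
    y ∈ regularPoints P ∧
      cell P y = {z | ∀ i, b.IsPos i → n i < P.coroot' i z ∧ P.coroot' i z < n i + 1} := by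
  have hreg (i : ι) (hi : b.IsPos i) (k : ℤ) : P.coroot' i y ≠ k := by
    intro hk
    have := h i hi
    rw [hk] at this
    norm_cast at this
    omega
  have hfl (i : ι) (hi : b.IsPos i) : ⌊P.coroot' i y⌋ = n i :=
    Int.floor_eq_iff.2 ⟨(h i hi).1.le, (h i hi).2⟩
  have hflneg (i j : ι) (hj : b.IsPos j) (hij : ∀ z, P.coroot' i z = -P.coroot' j z) :
      ⌊P.coroot' i y⌋ = -n j - 1 := by
    rw [hij, Int.floor_eq_iff]
    push_cast
    constructor <;> linarith [h j hj]
  refine ⟨fun i k hk ↦ ?_, ext fun z ↦ ⟨fun hz i hi ↦ ?_, fun hz i ↦ ?_⟩⟩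
  · rcases isPos_or_exists_coroot'_eq_neg b i with hi | ⟨j, hj, hij⟩
    · exact hreg i hi k hk
    · refine hreg j hj (-k) ?_
      rw [hij] at hk
      push_cast
      linarith
  · rw [← hfl i hi]
    exact hz i
  · rcases isPos_or_exists_coroot'_eq_neg b i with hi | ⟨j, hj, hij⟩
    · rw [hfl i hi]
      exact hz i hi
    · rw [hflneg i j hj hij, hij]
      push_cast
      constructor <;> linarith [hz j hj]

lemma IsEuclidean.cell_eq_stripIntersection (hP : IsEuclidean P) (b : P.Base) {a : V}
    (ha : a ∈ stripIntersection (positiveRoots b)) :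
    a ∈ regularPoints P ∧ cell P a = stripIntersection (positiveRoots b) := by
  rw [hP.mem_stripIntersection_positiveRoots] at ha
  obtain ⟨h1, h2⟩ := mem_regularPoints_and_cell_eq b (y := a) 0 (by simpa using ha)
  refine ⟨h1, h2.trans (ext fun z ↦ ?_)⟩
  simp [hP.mem_stripIntersection_positiveRoots]

/-- A reflection in a hyperplane that separates `z` from `a` moves `z` closer to `a`. -/
lemma IsEuclidean.dist_affineReflection_lt (hP : IsEuclidean P) (i : ι) (k : ℤ) {z a : V}
    (h : (P.coroot' i z - k) * (P.coroot' i a - k) < 0) :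
    dist (affineReflection (P.root i) k z) a < dist z a := by
  rw [dist_eq_norm, dist_eq_norm]
  refine lt_of_pow_lt_pow_left₀ 2 (norm_nonneg _) ?_
  have h1 : affineReflection (P.root i) k z - a =
      (z - a) - (P.coroot' i z - k) • P.root i := by
    rw [hP.affineReflection_eq]
    abel
  rw [h1, norm_sub_sq_real, inner_smul_right, real_inner_comm, hP.inner_root, map_sub, norm_smul,
    mul_pow, Real.norm_eq_abs, sq_abs, ← real_inner_self_eq_norm_sq (P.root i)]
  have h2 := mul_neg_of_neg_of_pos h (inner_root_self_pos P i)
  nlinarith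

variable [Finite ι] [P.IsCrystallographic] [P.IsRootSystem] [FiniteDimensional ℝ V]

/-- Orbits of the affine Weyl group are locally finite: the coordinates of the points of an orbit
in a bounded set have only finitely many possible values. -/
lemma IsEuclidean.finite_orbit_inter_closedBall (hP : IsEuclidean P) (b : P.Base)
    (y a : V) (r : ℝ) :
    {z | (∃ g ∈ affineWeylGroup (roots P), z = g y) ∧ dist z a ≤ r}.Finite := by
  have hcont (i : ι) : Continuous (P.coroot' i) := LinearMap.continuous_of_finiteDimensional _
  choose C hC using fun i ↦
    (isCompact_closedBall a r).exists_bound_of_continuousOn (hcont i).continuousOn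
  let S (i : ι) : Set ℝ := ⋃ j, (fun n : ℤ ↦ P.coroot' j y + n) ''
    Icc ⌊-C i - P.coroot' j y⌋ ⌈C i - P.coroot' j y⌉
  have hS : (univ.pi S).Finite :=
    Finite.pi fun i ↦ finite_iUnion fun j ↦ (finite_Icc _ _).image _
  refine (hS.subset ?_).of_finite_image (f := fun z i ↦ P.coroot' i z) fun z _ z' _ h ↦
    b.eq_of_forall_coroot'_eq fun j _ ↦ congrFun h j
  rintro _ ⟨_, ⟨⟨g, hg, rfl⟩, hr⟩, rfl⟩ i -
  obtain ⟨j, n, h⟩ := hP.exists_coroot'_apply_eq hg i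
  have hb := hC i (g y) hr
  rw [Real.norm_eq_abs, abs_le, h] at hb
  refine mem_iUnion.2 ⟨j, n, ⟨?_, ?_⟩, (h y).symm⟩
  · exact_mod_cast (Int.floor_le _).trans (by linarith : -C i - P.coroot' j y ≤ n)
  · exact_mod_cast (by linarith : (n : ℝ) ≤ C i - P.coroot' j y).trans (Int.le_ceil _)

/-- The affine Weyl group acts transitively on the alcoves: the point of the orbit of `y` that is
closest to a point of the fundamental alcove lies in the fundamental alcove. -/
lemma IsEuclidean.exists_apply_mem_stripIntersection (hP : IsEuclidean P) (b : P.Base) {a : V}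
    (ha : a ∈ stripIntersection (positiveRoots b)) {y : V} (hy : y ∈ regularPoints P) :
    ∃ g ∈ affineWeylGroup (roots P), g y ∈ stripIntersection (positiveRoots b) := by
  obtain ⟨_, ⟨⟨g, hg, rfl⟩, hgy⟩, hmin⟩ := exists_min_image _ (fun z ↦ dist z a)
    (hP.finite_orbit_inter_closedBall b y a (dist y a)) ⟨y, ⟨1, one_mem _, rfl⟩, le_rfl⟩
  refine ⟨g, hg, ?_⟩
  have key (i : ι) (k : ℤ) : ¬ (P.coroot' i (g y) - k) * (P.coroot' i a - k) < 0 := by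
    intro h
    have hlt := hP.dist_affineReflection_lt i k h
    refine hlt.not_ge (hmin _ ⟨⟨affineReflection (P.root i) k * g, mul_mem ?_ hg, rfl⟩, ?_⟩)
    · exact Subgroup.subset_closure ⟨_, ⟨i, rfl⟩, k, rfl⟩
    · exact hlt.le.trans hgy
  have hreg := hP.apply_mem_regularPoints hg hy
  rw [hP.mem_stripIntersection_positiveRoots] at ha ⊢
  intro i hi
  obtain ⟨ha0, ha1⟩ := ha i hi
  have h0 := key i 0
  have h1 := key i 1
  have r0 := hreg i 0
  have r1 := hreg i 1
  push_cast at h0 h1 r0 r1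
  constructor
  · by_contra! h
    exact h0 (mul_neg_of_neg_of_pos (by linarith [lt_of_le_of_ne h r0]) (by linarith))
  · by_contra! h
    exact h1 (mul_neg_of_pos_of_neg (by linarith [lt_of_le_of_ne h r1.symm]) (by linarith))

omit [Finite ι] [P.IsCrystallographic] [P.IsRootSystem] in
/-- The points `z` with `0 ≤ (z, α^∨) ≤ 1` for all positive `α` are the limits of points of the
fundamental alcove on the segments joining them to one of its points. -/
lemma IsEuclidean.mem_closure_stripIntersection (hP : IsEuclidean P) (b : P.Base) {a : V}
    (ha : a ∈ stripIntersection (positiveRoots b)) {z : V} :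
    z ∈ closure (stripIntersection (positiveRoots b)) ↔
      ∀ i, b.IsPos i → 0 ≤ P.coroot' i z ∧ P.coroot' i z ≤ 1 := by
  have hcont (i : ι) : Continuous (P.coroot' i) := LinearMap.continuous_of_finiteDimensional _
  constructor
  · intro hz i hi
    have hcl : IsClosed (P.coroot' i ⁻¹' Icc 0 1) := isClosed_Icc.preimage (hcont i)
    refine closure_minimal (fun y hy ↦ ?_) hcl hz
    have := (hP.mem_stripIntersection_positiveRoots b).1 hy i hi
    exact ⟨this.1.le, this.2.le⟩
  · intro hz
    rw [hP.mem_stripIntersection_positiveRoots] at ha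
    have hlim : Filter.Tendsto (fun t : ℝ ↦ z + t • (a - z)) (𝓝[>] 0) (𝓝 z) := by
      have : Continuous fun t : ℝ ↦ z + t • (a - z) := by fun_prop
      have := this.tendsto 0
      rw [zero_smul, add_zero] at this
      exact this.mono_left nhdsWithin_le_nhds
    refine mem_closure_of_tendsto hlim ?_
    filter_upwards [Ioo_mem_nhdsGT (zero_lt_one' ℝ)] with t ht
    rw [hP.mem_stripIntersection_positiveRoots]
    intro i hi
    obtain ⟨z0, z1⟩ := hz i hi
    obtain ⟨a0, a1⟩ := ha i hi
    rw [map_add, map_smul, map_sub, smul_eq_mul]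
    constructor <;> nlinarith [ht.1, ht.2]

variable [P.IsReduced]

omit [P.IsRootSystem] in
/-- The affine Weyl group acts freely on the alcoves. An element that preserves the fundamental
alcove maps `0` to a point of the root lattice in the closure of this alcove, that is, to `0`, hence
it lies in the Weyl group and preserves the set of the positive roots. -/
lemma IsEuclidean.eq_one_of_image_stripIntersection (hP : IsEuclidean P) (b : P.Base) {a : V}
    (ha : a ∈ stripIntersection (positiveRoots b)) {g : V ≃ᵃ[ℝ] V}
    (hg : g ∈ affineWeylGroup (roots P))
    (h : g '' stripIntersection (positiveRoots b) = stripIntersection (positiveRoots b)) :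
    g = 1 := by
  obtain ⟨u, hu, l, hl, hgz⟩ := hP.exists_eq_smul_add hg
  have hl0 : l = 0 := by
    refine eq_zero_of_mem_closure_root_of_coroot'_le_one hl fun i ↦ ?_
    have h0 : (0 : V) ∈ closure (stripIntersection (positiveRoots b)) :=
      (hP.mem_closure_stripIntersection b ha).2 fun i _ ↦ by simp
    have hlc : l ∈ closure (stripIntersection (positiveRoots b)) := by
      have := image_closure_subset_closure_image
        g.toAffineMap.continuous_of_finiteDimensional (mem_image_of_mem g h0)
      rwa [hgz, smul_zero, zero_add, AffineEquiv.coe_toAffineMap, h] at this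
    rw [hP.mem_closure_stripIntersection b ha] at hlc
    rcases isPos_or_exists_coroot'_eq_neg b i with hi | ⟨j, hj, hij⟩
    · exact (hlc i hi).2
    · rw [hij]
      linarith [(hlc j hj).1]
  have hu1 : u = 1 := by
    refine b.eq_one_of_forall_isPos_smul hu fun i hi ↦ ?_
    have hua : u • a ∈ stripIntersection (positiveRoots b) := by
      have := mem_image_of_mem g ha
      rwa [h, hgz, hl0, add_zero] at this
    rw [hP.mem_stripIntersection_positiveRoots] at ha hua
    have h1 := (ha i (b.isPos_of_mem_support hi)).1
    rw [← coroot'_aut_smul u] at h1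
    rcases isPos_or_exists_coroot'_eq_neg b (u • i) with hi | ⟨j, hj, hij⟩
    · exact hi
    · rw [hij] at h1
      linarith [(hua j hj).1]
  ext z
  rw [hgz, hu1, hl0, one_smul, add_zero]
  rfl

end Transitivity

/-! ### The special point, its stabilizer and its alcove -/

section SpecialPoint

variable {ι V N : Type*} [NormedAddCommGroup V] [InnerProductSpace ℝ V]
    [AddCommGroup N] [Module ℝ N] {P : RootPairing ι ℝ V N}

/-- The action of the automorphisms of the root system on `V` as affine maps fixing `x` instead of
the origin: the conjugate of the linear action by the translation by `x`. -/
def autAt (P : RootPairing ι ℝ V N) (x : V) : P.Aut →* (V ≃ᵃ[ℝ] V) where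
  toFun u := AffineEquiv.constVAdd ℝ V x * (Equiv.weightHom P u).toAffineEquiv *
    (AffineEquiv.constVAdd ℝ V x)⁻¹
  map_one' := by
    ext z
    change x + (-x + z) = z
    abel
  map_mul' u v := by
    ext z
    simp [AffineEquiv.inv_def]

lemma autAt_apply (x : V) (u : P.Aut) (z : V) : autAt P x u z = x + u • (-x + z) := rfl

lemma autAt_injective (x : V) : Function.Injective (autAt P x) := by
  intro u v h
  apply Equiv.weightHom_injective P
  ext z
  have := DFunLike.congr_fun h (x + z)
  rw [autAt_apply, autAt_apply, neg_add_cancel_left] at this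
  exact add_left_cancel this

lemma IsEuclidean.autAt_reflection (hP : IsEuclidean P) {x : V} {i : ι} {k : ℤ}
    (h : P.coroot' i x = k) :
    autAt P x (Equiv.reflection P i) = affineReflection (P.root i) k := by
  ext z
  rw [autAt_apply, hP.affineReflection_eq, Equiv.reflection_smul, reflection_apply, map_add,
    map_neg, h]
  module

/-- If `x` lies on the hyperplanes `H_{α,1}` for the simple roots `α`, its stabilizer in the affine
Weyl group is a conjugate of the Weyl group by a translation. -/
lemma IsEuclidean.map_autAt_eq [Finite ι] [P.IsCrystallographic] [P.IsReduced]
    (hP : IsEuclidean P) (b : P.Base) {x : V} (hx : ∀ j ∈ b.support, P.coroot' j x = 1) :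
    pointStabilizer (roots P) x = P.weylGroup.map (autAt P x) ∧
      P.weylGroup.map (autAt P x) =
        Subgroup.closure {g | ∃ α ∈ simpleRoots b, g = affineReflection α 1} := by
  have hmap : P.weylGroup.map (autAt P x) =
      Subgroup.closure {g | ∃ α ∈ simpleRoots b, g = affineReflection α 1} := by
    rw [b.weylGroup_eq_closure_simple, MonoidHom.map_closure]
    congr 1
    ext g
    simp only [simpleRoots, mem_image, exists_exists_and_eq_and, mem_ofPred_eq]
    refine exists_congr fun j ↦ and_congr_right fun hj ↦ ?_
    rw [hP.autAt_reflection (k := 1) (by simpa using hx j hj), eq_comm]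
  refine ⟨le_antisymm ?_ ?_, hmap⟩
  · rintro g ⟨hg, hgx⟩
    obtain ⟨u, hu, l, -, h⟩ := hP.exists_eq_smul_add hg
    refine ⟨u, hu, ?_⟩
    ext z
    rw [h] at hgx
    rw [autAt_apply, h, smul_add, smul_neg]
    nth_rw 1 [← hgx]
    abel
  · rw [hmap, Subgroup.closure_le]
    rintro _ ⟨_, ⟨j, hj, rfl⟩, rfl⟩
    refine ⟨Subgroup.subset_closure ⟨_, ⟨j, rfl⟩, 1, rfl⟩, ?_⟩
    rw [hP.affineReflection_eq, hx j hj, Int.cast_one, sub_self, zero_smul, sub_zero]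

/-- The image of the fundamental alcove under the point reflection `z ↦ x - z`. -/
def oppositeAlcove (b : P.Base) (x : V) : Set V :=
  {z | x - z ∈ stripIntersection (positiveRoots b)}

lemma IsEuclidean.mem_closure_oppositeAlcove [FiniteDimensional ℝ V] (hP : IsEuclidean P)
    (b : P.Base) {a : V} (ha : a ∈ stripIntersection (positiveRoots b)) (x : V) {z : V} :
    z ∈ closure (oppositeAlcove b x) ↔
      ∀ i, b.IsPos i → 0 ≤ P.coroot' i (x - z) ∧ P.coroot' i (x - z) ≤ 1 := by
  rw [← hP.mem_closure_stripIntersection b ha]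
  have := (Homeomorph.subLeft x).preimage_closure (stripIntersection (positiveRoots b))
  exact (Set.ext_iff.1 this z).symm

section Integral

variable {x : V} {n : ι → ℤ}

/-- If all `(x, α^∨)` are integers, then `x - A_e` is an alcove, because the point reflection
`z ↦ x - z` permutes the hyperplanes of the arrangement. -/
lemma IsEuclidean.cell_eq_oppositeAlcove (hP : IsEuclidean P) (b : P.Base)
    (hn : ∀ i, P.coroot' i x = n i) {y : V} (hy : y ∈ oppositeAlcove b x) :
    y ∈ regularPoints P ∧ cell P y = oppositeAlcove b x := by
  have hiff (z : V) : z ∈ oppositeAlcove b x ↔ ∀ i, b.IsPos i →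
      ((n i - 1 : ℤ) : ℝ) < P.coroot' i z ∧ P.coroot' i z < (n i - 1 : ℤ) + 1 := by
    rw [oppositeAlcove, mem_ofPred_eq, hP.mem_stripIntersection_positiveRoots]
    refine forall₂_congr fun i _ ↦ ?_
    rw [map_sub, hn]
    push_cast
    constructor <;> rintro ⟨h1, h2⟩ <;> constructor <;> linarith
  obtain ⟨h1, h2⟩ := mem_regularPoints_and_cell_eq b _ ((hiff y).1 hy)
  exact ⟨h1, h2.trans (ext fun z ↦ (hiff z).symm)⟩

/-- The point `x` is a vertex: on the closed alcove the simple coroots are at most `1`, and `x` is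
the only point where all of them equal `1`. -/
lemma IsEuclidean.isVertex_oppositeAlcove [FiniteDimensional ℝ V] [P.IsRootSystem]
    (hP : IsEuclidean P) (b : P.Base) (hx : ∀ j ∈ b.support, P.coroot' j x = 1) {a : V}
    (ha : a ∈ stripIntersection (positiveRoots b)) :
    IsVertex (oppositeAlcove b x) x := by
  have hle (y : V) (hy : y ∈ closure (oppositeAlcove b x)) (j : ι) (hj : j ∈ b.support) :
      P.coroot' j y ≤ 1 := by
    have := ((hP.mem_closure_oppositeAlcove b ha x).1 hy j (b.isPos_of_mem_support hj)).1
    rw [map_sub, hx j hj] at this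
    linarith
  rw [IsVertex, mem_extremePoints]
  refine ⟨(hP.mem_closure_oppositeAlcove b ha x).2 fun i _ ↦ by simp [-LinearMap.flip_apply], ?_⟩
  rintro y hy z hz ⟨s, t, hs, ht, hst, h⟩
  have hj (j : ι) (hj : j ∈ b.support) : P.coroot' j y = 1 ∧ P.coroot' j z = 1 := by
    have h1 := hx j hj
    have hy1 := hle y hy j hj
    have hz1 := hle z hz j hj
    rw [← h, map_add, map_smul, map_smul, smul_eq_mul, smul_eq_mul] at h1
    constructor <;> nlinarith
  exact ⟨b.eq_of_forall_coroot'_eq fun j h ↦ by rw [(hj j h).1, hx j h],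
    b.eq_of_forall_coroot'_eq fun j h ↦ by rw [(hj j h).2, hx j h]⟩

/-- An alcove in the fundamental parallelepiped with vertex `x` has points close to `x`, and these
lie just below the hyperplane through `x` for every positive root. -/
lemma IsEuclidean.eq_oppositeAlcove [Finite ι] [FiniteDimensional ℝ V] [P.IsRootSystem]
    (hP : IsEuclidean P) (b : P.Base) (hn : ∀ i, P.coroot' i x = n i)
    (hx : ∀ j ∈ b.support, P.coroot' j x = 1) {A : Set V} (hA : IsAlcove (roots P) A)
    (hAP : A ⊆ parallelepiped b) (hAx : IsVertex A x) : A = oppositeAlcove b x := by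
  obtain ⟨y, -, rfl⟩ := (hP.isAlcove_iff A).1 hA
  have hcont (i : ι) : Continuous (P.coroot' i) := LinearMap.continuous_of_finiteDimensional _
  obtain ⟨z, hzx, hz⟩ := mem_closure_iff.1 hAx.1 (⋂ i, {z | P.coroot' i x - 1 < P.coroot' i z})
    (isOpen_iInter_of_finite fun i ↦ isOpen_lt continuous_const (hcont i)) (by simp)
  simp only [mem_iInter, mem_ofPred_eq] at hzx
  rw [← cell_eq_of_mem hz]
  refine (hP.cell_eq_oppositeAlcove b hn ?_).2
  rw [oppositeAlcove, mem_ofPred_eq, hP.mem_stripIntersection_positiveRoots]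
  intro i hi
  rw [map_sub]
  refine ⟨?_, by linarith [hzx i]⟩
  obtain ⟨f, hf, hfz⟩ := hP.exists_coroot'_eq_sum_of_isPos b hi
  rw [hfz, hfz, ← Finset.sum_sub_distrib]
  have hlt (j : ι) (hj : j ∈ b.support) : P.coroot' j z < P.coroot' j x := by
    rw [hx j hj]
    exact ((hP.mem_parallelepiped b).1 (hAP hz) j hj).2
  obtain ⟨j, hj, hfj⟩ : ∃ j ∈ b.support, f j ≠ 0 := by
    by_contra! h
    rw [Finset.sum_eq_zero h] at hf
    omega
  refine Finset.sum_pos' (fun j hj ↦ ?_) ⟨j, hj, ?_⟩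
  · rw [← mul_sub]
    exact mul_nonneg (Nat.cast_nonneg _) (sub_nonneg.2 (hlt j hj).le)
  · rw [← mul_sub]
    exact mul_pos (by positivity) (sub_pos.2 (hlt j hj))

/-- The closed alcove contains small multiples, based at `x`, of minus all dominant vectors, and
those orthogonal to `α` span the hyperplane orthogonal to `α`. -/
lemma IsEuclidean.isWall_oppositeAlcove [Finite ι] [FiniteDimensional ℝ V] [P.IsRootSystem]
    (hP : IsEuclidean P) (b : P.Base) (hx : ∀ j ∈ b.support, P.coroot' j x = 1) {a : V}
    (ha : a ∈ stripIntersection (positiveRoots b)) {i : ι} (hi : i ∈ b.support) :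
    IsWall (roots P) (oppositeAlcove b x) (hyperplane (P.root i) 1) := by
  refine ⟨⟨_, ⟨i, rfl⟩, 1, rfl⟩, ?_⟩
  rw [hP.hyperplane_eq, Int.cast_one]
  set S := closure (oppositeAlcove b x) ∩ {z | P.coroot' i z = 1}
  have hxS : x ∈ S :=
    ⟨(hP.mem_closure_oppositeAlcove b ha x).2 fun i _ ↦ by simp [-LinearMap.flip_apply], hx i hi⟩
  have hdir (p : V) (hp : ∀ j ∈ b.support, 0 ≤ P.coroot' j p) (hip : P.coroot' i p = 0) :
      p ∈ (affineSpan ℝ S).direction := by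
    obtain ⟨C, hC⟩ := (Set.finite_range fun j ↦ P.coroot' j p).bddAbove
    have hC' : 0 < |C| + 1 := by positivity
    have hmem : x - (|C| + 1)⁻¹ • p ∈ S := by
      refine ⟨(hP.mem_closure_oppositeAlcove b ha x).2 fun j hj ↦ ?_, ?_⟩
      · rw [sub_sub_cancel, map_smul, smul_eq_mul]
        obtain ⟨f, -, hf⟩ := hP.exists_coroot'_eq_sum_of_isPos b hj
        have h0 : 0 ≤ P.coroot' j p := by
          rw [hf]
          exact Finset.sum_nonneg fun k hk ↦ mul_nonneg (Nat.cast_nonneg _) (hp k hk)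
        refine ⟨by positivity, ?_⟩
        rw [inv_mul_le_one₀ hC']
        linarith [hC (mem_range_self j), le_abs_self C]
      · rw [mem_ofPred_eq, map_sub, map_smul, hip, hx i hi, smul_zero, sub_zero]
    have := AffineSubspace.vsub_mem_direction (subset_affineSpan ℝ S hxS)
      (subset_affineSpan ℝ S hmem)
    rw [vsub_eq_sub, sub_sub_cancel] at this
    exact (Submodule.smul_mem_iff _ (inv_ne_zero hC'.ne')).1 this
  refine subset_antisymm (fun z hz ↦ ?_) fun z hz ↦ ?_
  · refine affineSpan_induction (p := fun z ↦ P.coroot' i z = 1) hz (fun z hz ↦ hz.2) ?_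
    intro c u v w hu hv hw
    rw [vsub_eq_sub, vadd_eq_add, map_add, map_smul, map_sub, hu, hv, hw]
    simp
  · -- The positive and negative parts of the coordinates of `x - z` are dominant.
    obtain ⟨p, hp⟩ := b.exists_coroot'_eq fun j ↦ (P.coroot' j (x - z))⁺
    obtain ⟨q, hq⟩ := b.exists_coroot'_eq fun j ↦ (P.coroot' j (x - z))⁻
    have hiz : P.coroot' i (x - z) = 0 := by
      rw [map_sub, hx i hi, show P.coroot' i z = 1 from hz, sub_self]
    have hpq : x - z = p - q := b.eq_of_forall_coroot'_eq fun j hj ↦ by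
      rw [map_sub _ p, hp j hj, hq j hj, posPart_sub_negPart]
    have hp' := hdir p (fun j hj ↦ by rw [hp j hj]; exact posPart_nonneg _)
      (by rw [hp i hi, hiz, posPart_zero])
    have hq' := hdir q (fun j hj ↦ by rw [hq j hj]; exact negPart_nonneg _)
      (by rw [hq i hi, hiz, negPart_zero])
    have := AffineSubspace.vadd_mem_of_mem_direction (sub_mem hq' hp')
      (subset_affineSpan ℝ S hxS)
    rwa [vadd_eq_add, ← neg_sub p q, ← hpq, neg_sub, sub_add_cancel] at this

end Integral

end SpecialPoint

end AffineWeyl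

end

theorem mainTheorem3 {ι V N : Type*} [Finite ι]
    [NormedAddCommGroup V] [InnerProductSpace ℝ V] [FiniteDimensional ℝ V]
    [AddCommGroup N] [Module ℝ N]
    (P : RootPairing ι ℝ V N) [P.IsRootSystem] [P.IsCrystallographic] [P.IsReduced]
    [P.IsIrreducible] (hP : AffineWeyl.IsEuclidean P) (b : P.Base) :
    ∃ x : V,
      (⋂ α ∈ AffineWeyl.simpleRoots b, AffineWeyl.hyperplane α 1) = {x} ∧
      (∃ w ∈ AffineWeyl.affineWeylGroup (AffineWeyl.roots P),
        (AffineWeyl.IsAlcove (AffineWeyl.roots P) (AffineWeyl.alcove b w) ∧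
          AffineWeyl.alcove b w ⊆ AffineWeyl.parallelepiped b ∧
          AffineWeyl.IsVertex (AffineWeyl.alcove b w) x) ∧
        (∀ A : Set V, AffineWeyl.IsAlcove (AffineWeyl.roots P) A →
          A ⊆ AffineWeyl.parallelepiped b → AffineWeyl.IsVertex A x →
          A = AffineWeyl.alcove b w) ∧
        (∀ w' ∈ AffineWeyl.affineWeylGroup (AffineWeyl.roots P),
          AffineWeyl.alcove b w' = AffineWeyl.alcove b w → w' = w) ∧
        (∀ α ∈ AffineWeyl.simpleRoots b,
          AffineWeyl.IsWall (AffineWeyl.roots P) (AffineWeyl.alcove b w)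
            (AffineWeyl.hyperplane α 1))) ∧
      AffineWeyl.IsSpecial P x ∧
      AffineWeyl.pointStabilizer (AffineWeyl.roots P) x =
        Subgroup.closure
          {g | ∃ α ∈ AffineWeyl.simpleRoots b, g = AffineWeyl.affineReflection α 1} := by
  open AffineWeyl in
  obtain ⟨x, hx⟩ := b.exists_coroot'_eq fun _ ↦ 1
  have hpos (i : ι) (hi : b.IsPos i) : ∃ n : ℤ, 1 ≤ n ∧ P.coroot' i x = n := by
    obtain ⟨f, hf, hfz⟩ := hP.exists_coroot'_eq_sum_of_isPos b hi
    refine ⟨(∑ j ∈ b.support, f j : ℕ), by exact_mod_cast hf, ?_⟩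
    rw [hfz, Finset.sum_congr rfl fun j hj ↦ by rw [hx j hj, mul_one]]
    push_cast
    rfl
  have hint (i : ι) : ∃ n : ℤ, P.coroot' i x = n := by
    rcases isPos_or_exists_coroot'_eq_neg b i with hi | ⟨j, hj, hij⟩
    · obtain ⟨n, -, h⟩ := hpos i hi
      exact ⟨n, h⟩
    · obtain ⟨n, -, h⟩ := hpos j hj
      exact ⟨-n, by rw [hij, h, Int.cast_neg]⟩
  choose n hn using hint
  -- The fundamental alcove contains the small positive multiples of `x`.
  obtain ⟨a, ha⟩ : (stripIntersection (positiveRoots b)).Nonempty := by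
    obtain ⟨C, hC⟩ := (Set.finite_range fun j ↦ P.coroot' j x).bddAbove
    have hC' : 0 < |C| + 1 := by positivity
    refine ⟨(|C| + 1)⁻¹ • x, (hP.mem_stripIntersection_positiveRoots b).2 fun i hi ↦ ?_⟩
    obtain ⟨m, hm, h⟩ := hpos i hi
    have h0 : 0 < P.coroot' i x := by
      rw [h]
      exact_mod_cast hm
    rw [map_smul, smul_eq_mul]
    refine ⟨by positivity, ?_⟩
    rw [inv_mul_lt_one₀ hC']
    linarith [hC (Set.mem_range_self i), le_abs_self C]
  have hxa : x - a ∈ oppositeAlcove b x := by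
    rwa [oppositeAlcove, Set.mem_ofPred_eq, sub_sub_cancel]
  obtain ⟨hreg, hcell⟩ := hP.cell_eq_oppositeAlcove b hn hxa
  obtain ⟨g, hg, hgxa⟩ := hP.exists_apply_mem_stripIntersection b ha hreg
  have hw : alcove b g⁻¹ = oppositeAlcove b x := by
    rw [alcove, ← (hP.cell_eq_stripIntersection b hgxa).2, hP.image_cell (inv_mem hg), ← hcell]
    exact congrArg _ (g.symm_apply_apply _)
  obtain ⟨hstab, hclosure⟩ := hP.map_autAt_eq b hx
  refine ⟨x, ?_, ⟨g⁻¹, inv_mem hg, ?_, ?_, ?_, ?_⟩, ?_, hstab.trans hclosure⟩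
  · ext z
    simp only [simpleRoots, Set.biInter_image, hP.hyperplane_eq, Set.mem_iInter,
      Set.mem_ofPred_eq, Int.cast_one, Set.mem_singleton_iff, Finset.mem_coe]
    refine ⟨fun h ↦ b.eq_of_forall_coroot'_eq fun j hj ↦ by rw [h j hj, hx j hj], ?_⟩
    rintro rfl
    exact hx
  · rw [hw]
    refine ⟨(hP.isAlcove_iff _).2 ⟨_, hreg, hcell.symm⟩, fun z hz ↦ ?_,
      hP.isVertex_oppositeAlcove b hx ha⟩
    rw [hP.mem_parallelepiped]
    intro j hj
    have := (hP.mem_stripIntersection_positiveRoots b).1 hz j (b.isPos_of_mem_support hj)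
    rw [map_sub, hx j hj] at this
    constructor <;> linarith
  · intro A hA hAP hAx
    rw [hw]
    exact hP.eq_oppositeAlcove b hn hx hA hAP hAx
  · intro w' hw' h
    have h1 : (g * w') '' stripIntersection (positiveRoots b) =
        stripIntersection (positiveRoots b) := by
      have h2 : g '' alcove b w' = g '' alcove b g⁻¹ := by rw [h]
      rw [alcove, alcove, Set.image_image, Set.image_image] at h2
      refine h2.trans ?_
      simp only [AffineEquiv.inv_def, AffineEquiv.apply_symm_apply, Set.image_id']
    exact (inv_eq_of_mul_eq_one_right
      (hP.eq_one_of_image_stripIntersection b ha (mul_mem hg hw') h1)).symm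
  · rintro _ ⟨i, hi, rfl⟩
    rw [hw]
    exact hP.isWall_oppositeAlcove b hx ha hi
  · rw [IsSpecial, hstab]
    exact ⟨(Subgroup.equivMapOfInjective _ _ (autAt_injective x)).symm⟩
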